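/- Let $\mathfrak l$ be a real Lie algebra and $(\mathfrak a,\langle\cdot,\cdot\rangle)$ a finite-dimensional real vector space with a non-degenerate symmetric bilinear form, regarded as a trivial $\mathfrak l$-module. Let $(C^*(\mathfrak l,\mathfrak a),d)$ be the Chevalley–Eilenberg complex and $C^*(\mathfrak l)=C^*(\mathfrak l,\mathbb R)$; for cochains with values in $\mathfrak a$ let $\langle\cdot\wedge\cdot\rangle$ be the exterior product followed by the inner product. Let $$\mathcal Z^2_Q(\mathfrak l,\mathfrak a)=\{(\alpha,\gamma)\in C^2(\mathfrak l,\mathfrak a)\oplus C^3(\mathfrak l)\mid d\alpha=0,\ d\gamma=\tfrac12\langle\alpha\wedge\alpha\rangle\},$$ and let $\mathcal H^2_Q(\mathfrak l,\mathfrak a)$ be the set of classes $[\alpha,\gamma]$ of its elements, where $(\alpha,\gamma)$ is identified with $(\alpha+d\tau,\ \gamma+d\sigma+\langle(\alpha+\tfrac12d\tau)\wedge\tau\rangle)$ for all $\tau\in C^1(\mathfrak l,\mathfrak a)$, $\sigma\in C^2(\mathfrak l)$. Write $\mathfrak l^1=\mathfrak l$, $\mathfrak l^{j+1}=[\mathfrak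 l,\mathfrak l^{j}]$, let $\mathfrak z(\mathfrak l)$ be the centre, $\mathfrak l_{(0)}=\mathfrak z(\mathfrak l)$ and $\mathfrak l_{(k)}=\mathfrak z(\mathfrak l)\cap\mathfrak l^{k+1}$ for $k\ge1$. Suppose that $\mathfrak l$ is nilpotent, and let $m\ge 0$ be such that $\mathfrak l^{m+2}=0$. A class $[\alpha,\gamma]$ is *admissible* if for all $0\le k\le m$ the following two conditions hold (they do not depend on the choices of $m$ and of the representative). * $(A_k)$ If $L_0\in\mathfrak l_{(k)}$, and there are $A_0\in\mathfrak a$ and $Z_0\in(\mathfrak l^{k+1})^*$ such that for all $L\in\mathfrak l$ one has $\alpha(L,L_0)=0$ and $\gamma(L,L_0,\cdot)=-\langle A_0,\alpha(L,\cdot)\rangle+Z_0([L,\cdot])$ on $\mathfrak l^{k+1}$, then $L_0=0$. * $(B_k)$ The image under $\alpha$ of the kernel of the bracket map $\mathfrak l\otimes\mathfrak l^{k+1}\to\mathfrak l$ is a non-degenerate subspace of $\mathfrak a$. A class $\varphi\in\mathcal H^2_Q(\mathfrak l,\mathfrak a)$ is *decomposable* if there are an orthogonal decomposition $\mathfrak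 a=\mathfrak a_1\oplus\mathfrak a_2$ and a decomposition $\mathfrak l=\mathfrak l_1\oplus\mathfrak l_2$ into ideals, at least one of the two having both summands non-zero, and classes $\varphi_i=[\alpha_i,\gamma_i]\in\mathcal H^2_Q(\mathfrak l_i,\mathfrak a_i)$ such that $\varphi=[\,j_1q_1^*\alpha_1+j_2q_2^*\alpha_2,\ q_1^*\gamma_1+q_2^*\gamma_2\,]$, where $q_i:\mathfrak l\to\mathfrak l_i$ are the projections and $j_i:\mathfrak a_i\to\mathfrak a$ the inclusions. Let $\mathcal H^2_Q(\mathfrak l,\mathfrak a)_0$ be the set of admissible classes that are not decomposable. **Proposition.** Let $\mathfrak l$ be a nilpotent real Lie algebra with $\dim\mathfrak l=5$, and let $\mathfrak a=0$. If $\mathcal H^2_Q(\mathfrak l,\mathfrak a)_0\neq\emptyset$, then $\mathfrak l$ is isomorphic to the abelian Lie algebra $\mathbb R^5$ or to the Lie algebra $\mathfrak g_{5,2}$ with basis $X_1,X_2,X_3,Y,Z$ and brackets $[X_1,X_2]=Y$, $[X_1,X_3]=Z$, all other brackets of basis vectors being zero. -/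

import Mathlib

/-! # Quadratic cohomology of real Lie algebras and admissible, indecomposable classes -/

namespace QuadraticCohomology

/-- A finite-dimensional pseudo-Euclidean vector space: a finite-dimensional real vector space
with a non-degenerate symmetric bilinear form. -/
structure PseudoEuclidean (A : Type*) [AddCommGroup A] [Module ℝ A] where
  /-- the inner product -/
  form : LinearMap.BilinForm ℝ A
  finite : FiniteDimensional ℝ A
  symm : ∀ a b, form a b = form b a
  nondegenerate : form.Nondegenerate

/-- An orthogonal module of a Lie algebra `L`: a pseudo-Euclidean space with a representation of
`L` by skew-symmetric maps. -/
structure OrthogonalModule (L A : Type*) [LieRing L] [LieAlgebra ℝ L]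
    [AddCommGroup A] [Module ℝ A] extends PseudoEuclidean A where
  /-- the representation -/
  rho : L →ₗ[ℝ] Module.End ℝ A
  rho_lie : ∀ (x y : L) (a : A), rho ⁅x, y⁆ a = rho x (rho y a) - rho y (rho x a)
  skew : ∀ (x : L) (a b : A), form (rho x a) b + form a (rho x b) = 0

section Cochains

variable {L A : Type*} [LieRing L] [LieAlgebra ℝ L] [AddCommGroup A] [Module ℝ A]

/-- A pseudo-Euclidean space as a trivial orthogonal module of `L`. -/
def PseudoEuclidean.trivialModule (L : Type*) [LieRing L] [LieAlgebra ℝ L]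
    (E : PseudoEuclidean A) : OrthogonalModule L A where
  toPseudoEuclidean := E
  rho := 0
  rho_lie := by intro x y a; simp
  skew := by intro x a b; simp

/-- The differential `C¹(L, A) → C²(L, A)`; one-cochains are linear maps. -/
def d1 (V : OrthogonalModule L A) (τ : L →ₗ[ℝ] A) (x y : L) : A :=
  V.rho x (τ y) - V.rho y (τ x) - τ ⁅x, y⁆

/-- The differential `C²(L, A) → C³(L, A)`. -/
def d2 (V : OrthogonalModule L A) (α : L [⋀^Fin 2]→ₗ[ℝ] A) (x y z : L) : A :=
  V.rho x (α ![y, z]) - V.rho y (α ![x, z]) + V.rho z (α ![x, y])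
    - α ![⁅x, y⁆, z] + α ![⁅x, z⁆, y] - α ![⁅y, z⁆, x]

/-- The differential `C²(L) → C³(L)` for the trivial module `ℝ`. -/
def d2R (σ : L [⋀^Fin 2]→ₗ[ℝ] ℝ) (x y z : L) : ℝ :=
  - σ ![⁅x, y⁆, z] + σ ![⁅x, z⁆, y] - σ ![⁅y, z⁆, x]

/-- The differential `C³(L) → C⁴(L)` for the trivial module `ℝ`. -/
def d3R (γ : L [⋀^Fin 3]→ₗ[ℝ] ℝ) (x y z w : L) : ℝ :=
  - γ ![⁅x, y⁆, z, w] + γ ![⁅x, z⁆, y, w] - γ ![⁅x, w⁆, y, z]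
    - γ ![⁅y, z⁆, x, w] + γ ![⁅y, w⁆, x, z] - γ ![⁅z, w⁆, x, y]

/-- The product `⟨τ₁ ∧ τ₂⟩` of two one-cochains. -/
def wedge11 (B : LinearMap.BilinForm ℝ A) (τ₁ τ₂ : L →ₗ[ℝ] A) : L [⋀^Fin 2]→ₗ[ℝ] ℝ where
  toFun v := B (τ₁ (v 0)) (τ₂ (v 1)) - B (τ₁ (v 1)) (τ₂ (v 0))
  map_update_add' := by
    intro inst v i x y
    rw [Subsingleton.elim inst (instDecidableEqFin 2)]
    fin_cases i <;> simp <;> ring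
  map_update_smul' := by
    intro inst v i c x
    rw [Subsingleton.elim inst (instDecidableEqFin 2)]
    fin_cases i <;> simp <;> ring
  map_eq_zero_of_eq' := by
    intro v i j h hij
    fin_cases i <;> fin_cases j <;> simp_all

/-- The product `⟨β ∧ τ⟩` of a two-cochain (given as a function) and a one-cochain. -/
def wedge21 (B : LinearMap.BilinForm ℝ A) (β : L → L → A) (τ : L →ₗ[ℝ] A) (x y z : L) : ℝ :=
  B (β x y) (τ z) - B (β x z) (τ y) + B (β y z) (τ x)

/-- The product `⟨α ∧ β⟩` of two two-cochains. -/
def wedge22 (B : LinearMap.BilinForm ℝ A) (α β : L [⋀^Fin 2]→ₗ[ℝ] A) (x y z w : L) : ℝ :=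
  B (α ![x, y]) (β ![z, w]) - B (α ![x, z]) (β ![y, w]) + B (α ![x, w]) (β ![y, z])
    + B (α ![y, z]) (β ![x, w]) - B (α ![y, w]) (β ![x, z]) + B (α ![z, w]) (β ![x, y])

/-- Quadratic two-cocycles: pairs `(α, γ) ∈ C²(L, A) ⊕ C³(L)` with `dα = 0` and
`dγ = ½ ⟨α ∧ α⟩`. -/
structure QuadCocycle (V : OrthogonalModule L A) where
  /-- the part in `C²(L, A)` -/
  α : L [⋀^Fin 2]→ₗ[ℝ] A
  /-- the part in `C³(L)` -/
  γ : L [⋀^Fin 3]→ₗ[ℝ] ℝ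
  d_α : ∀ x y z, d2 V α x y z = 0
  d_γ : ∀ x y z w, d3R γ x y z w = 1 / 2 * wedge22 V.form α α x y z w

/-- `(α', γ')` is the image of `(α, γ)` under the quadratic one-cochain `(τ, σ)`, that is
`α' = α + dτ` and `γ' = γ + dσ + ⟨(α + ½ dτ) ∧ τ⟩`. -/
def Moves (V : OrthogonalModule L A) (τ : L →ₗ[ℝ] A) (σ : L [⋀^Fin 2]→ₗ[ℝ] ℝ)
    (c c' : QuadCocycle V) : Prop :=
  (∀ x y, c'.α ![x, y] = c.α ![x, y] + d1 V τ x y) ∧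
  (∀ x y z, c'.γ ![x, y, z] = c.γ ![x, y, z] + d2R σ x y z
    + wedge21 V.form (fun u v => c.α ![u, v] + (1 / 2 : ℝ) • d1 V τ u v) τ x y z)

theorem Moves.refl (V : OrthogonalModule L A) (c : QuadCocycle V) : Moves V 0 0 c c := by
  constructor <;> intros <;> simp [d1, d2R, wedge21]

theorem Moves.inv {V : OrthogonalModule L A} {τ : L →ₗ[ℝ] A} {σ : L [⋀^Fin 2]→ₗ[ℝ] ℝ}
    {c c' : QuadCocycle V} (h : Moves V τ σ c c') : Moves V (-τ) (-σ) c' c := by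
  obtain ⟨h1, h2⟩ := h
  constructor
  · intro x y
    rw [h1]
    simp only [d1, LinearMap.neg_apply, map_neg]
    abel
  · intro x y z
    rw [h2]
    simp only [h1, d1, d2R, wedge21, LinearMap.neg_apply, map_neg, map_add, map_sub, map_smul,
      LinearMap.add_apply, LinearMap.sub_apply, LinearMap.smul_apply, smul_eq_mul,
      AlternatingMap.neg_apply]
    ring

/-- Two moves compose according to the group law
`(τ, σ) * (τ', σ') = (τ + τ', σ + σ' + ½ ⟨τ ∧ τ'⟩)` of quadratic one-cochains. -/
theorem Moves.comp {V : OrthogonalModule L A} {τ τ' : L →ₗ[ℝ] A}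
    {σ σ' : L [⋀^Fin 2]→ₗ[ℝ] ℝ} {c c' c'' : QuadCocycle V}
    (h : Moves V τ σ c c') (h' : Moves V τ' σ' c' c'') :
    Moves V (τ + τ') (σ + σ' + (1 / 2 : ℝ) • wedge11 V.form τ τ') c c'' := by
  obtain ⟨h1, h2⟩ := h
  obtain ⟨h1', h2'⟩ := h'
  constructor
  · intro x y
    rw [h1', h1]
    simp only [d1, LinearMap.add_apply, map_add]
    abel
  · intro x y z
    rw [h2', h2]
    have sk : ∀ (u : L) (a b : A), V.form (V.rho u a) b = - V.form (V.rho u b) a := by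
      intro u a b
      have := V.skew u a b
      rw [V.symm a] at this
      linarith
    have e : ∀ u v w : L, wedge11 V.form τ τ' ![⁅u, v⁆, w]
        = V.form (τ ⁅u, v⁆) (τ' w) - V.form (τ' ⁅u, v⁆) (τ w) := by
      intro u v w
      rw [V.symm (τ' ⁅u, v⁆)]
      rfl
    simp only [h1, d1, d2R, wedge21, LinearMap.add_apply, map_add, map_sub, map_smul,
      LinearMap.sub_apply, LinearMap.smul_apply, smul_eq_mul,
      AlternatingMap.add_apply, AlternatingMap.smul_apply, e]
    rw [sk x (τ y) (τ' z), sk y (τ x) (τ' z), sk x (τ z) (τ' y), sk z (τ x) (τ' y),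
      sk y (τ z) (τ' x), sk z (τ y) (τ' x)]
    ring

/-- Two quadratic cocycles are equivalent if they lie in the same orbit of the group of
quadratic one-cochains. -/
def quadSetoid (V : OrthogonalModule L A) : Setoid (QuadCocycle V) where
  r c c' := ∃ τ σ, Moves V τ σ c c'
  iseqv :=
    ⟨fun c => ⟨_, _, Moves.refl V c⟩, fun ⟨_, _, h⟩ => ⟨_, _, h.inv⟩,
      fun ⟨_, _, h⟩ ⟨_, _, h'⟩ => ⟨_, _, h.comp h'⟩⟩

/-- The second quadratic cohomology set of `L` with coefficients in `V`. -/
def HQ (V : OrthogonalModule L A) : Type _ := Quotient (quadSetoid V)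

/-- The class `[α, γ]` of a quadratic cocycle. -/
def QuadCocycle.cls {V : OrthogonalModule L A} (c : QuadCocycle V) : HQ V :=
  Quotient.mk (quadSetoid V) c

/-! ### Admissible classes

In terms of the lower central series `L¹ = L`, `Lʲ⁺¹ = [L, Lʲ]`, the term `Lᵏ⁺¹` is
`LieModule.lowerCentralSeries ℝ L L k`. -/

/-- The term `Lᵏ⁺¹` of the lower central series. -/
abbrev lcs (L : Type*) [LieRing L] [LieAlgebra ℝ L] (k : ℕ) : LieSubmodule ℝ L L :=
  LieModule.lowerCentralSeries ℝ L L k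

/-- The subspaces `L₍₀₎ = 𝔷(L) ∩ ker ρ` and `L₍ₖ₎ = 𝔷(L) ∩ Lᵏ⁺¹` for `k ≥ 1`. -/
def centralPart (V : OrthogonalModule L A) : ℕ → Submodule ℝ L
  | 0 => (LieAlgebra.center ℝ L).toSubmodule ⊓ LinearMap.ker V.rho
  | k + 1 => (LieAlgebra.center ℝ L).toSubmodule ⊓ (lcs L (k + 1)).toSubmodule

/-- Condition `(Aₖ)`. -/
def CondA (V : OrthogonalModule L A) (c : QuadCocycle V) (k : ℕ) : Prop :=
  ∀ L₀ ∈ centralPart V k,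
    (∃ (A₀ : A) (Z₀ : Module.Dual ℝ (lcs L k)), ∀ x : L,
      c.α ![x, L₀] = 0 ∧
      ∀ y : lcs L k, c.γ ![x, L₀, (y : L)] = - V.form A₀ (c.α ![x, (y : L)]) + Z₀ ⁅x, y⁆) →
    L₀ = 0

theorem update_pair_zero {M : Type*} (x y a : M) : Function.update ![x, y] 0 a = ![a, y] := by
  ext i; fin_cases i <;> rfl

theorem update_pair_one {M : Type*} (x y a : M) : Function.update ![x, y] 1 a = ![x, a] := by
  ext i; fin_cases i <;> rfl

/-- A two-cochain as a bilinear map. -/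
def bilin (α : L [⋀^Fin 2]→ₗ[ℝ] A) : L →ₗ[ℝ] L →ₗ[ℝ] A :=
  LinearMap.mk₂ ℝ (fun x y => α ![x, y])
    (fun x x' y => by
      have h := α.map_update_add ![x, y] 0 x x'
      rwa [update_pair_zero, update_pair_zero, update_pair_zero] at h)
    (fun r x y => by
      have h := α.map_update_smul ![x, y] 0 r x
      rwa [update_pair_zero, update_pair_zero] at h)
    (fun x y y' => by
      have h := α.map_update_add ![x, y] 1 y y'
      rwa [update_pair_one, update_pair_one, update_pair_one] at h)
    (fun r x y => by
      have h := α.map_update_smul ![x, y] 1 r y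
      rwa [update_pair_one, update_pair_one] at h)

/-- The subspace `α(ker [·,·]_{L ⊗ Lᵏ⁺¹})` of `A`. -/
def kernelImage (α : L [⋀^Fin 2]→ₗ[ℝ] A) (k : ℕ) : Submodule ℝ A :=
  (LinearMap.ker
      (LieModule.toModuleHom ℝ L (lcs L k) : TensorProduct ℝ L (lcs L k) →ₗ[ℝ] lcs L k)).map
    (TensorProduct.lift ((bilin α).compl₂ (lcs L k).toSubmodule.subtype))

/-- Condition `(Bₖ)`. -/
def CondB (V : OrthogonalModule L A) (c : QuadCocycle V) (k : ℕ) : Prop :=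
  (V.form.restrict (kernelImage c.α k)).Nondegenerate

/-- Admissible classes in `H²_Q(L, V)`, for `L` nilpotent and `V` semi-simple: the class has a
representative `(α, γ)` with `α(L, L) ⊆ Aᴸ` such that `(Aₖ)` and `(Bₖ)` hold for `0 ≤ k ≤ m`, where
`Lᵐ⁺² = 0`. -/
def Admissible (V : OrthogonalModule L A) (φ : HQ V) : Prop :=
  ∃ c : QuadCocycle V, c.cls = φ ∧ (∀ x y z : L, V.rho z (c.α ![x, y]) = 0) ∧
    ∃ m : ℕ, lcs L (m + 1) = ⊥ ∧ ∀ k ≤ m, CondA V c k ∧ CondB V c k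

end Cochains

section Decomposable

variable (L : Type*) [LieRing L] [LieAlgebra ℝ L] {A : Type*} [AddCommGroup A] [Module ℝ A]

/-- A class `φ ∈ H²_Q(L, A)`, `A` a trivial module, is decomposable if there are an orthogonal
decomposition `A = a₁ ⊕ a₂` and a decomposition `L = I₁ ⊕ I₂` into ideals, at least one of them
non-trivial, and classes `φᵢ ∈ H²_Q(Iᵢ, aᵢ)` with `φ = (q₁, j₁)^* φ₁ + (q₂, j₂)^* φ₂`. Here
`qᵢ : L → Iᵢ` are the projections, `jᵢ : aᵢ → A` the inclusions, `E₁`, `E₂` are the induced inner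
products on `a₁`, `a₂`, and pull-backs and the sum are formed on representing cocycles. -/
def Decomposable (E : PseudoEuclidean A) (φ : HQ (E.trivialModule L)) : Prop :=
  ∃ (I₁ I₂ : LieIdeal ℝ L) (a₁ a₂ : Submodule ℝ A)
    (E₁ : PseudoEuclidean a₁) (E₂ : PseudoEuclidean a₂)
    (hI : IsCompl I₁.toSubmodule I₂.toSubmodule),
    IsCompl a₁ a₂ ∧ (∀ x ∈ a₁, ∀ y ∈ a₂, E.form x y = 0) ∧
    (∀ x y : a₁, E₁.form x y = E.form x y) ∧ (∀ x y : a₂, E₂.form x y = E.form x y) ∧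
    ((I₁ ≠ ⊥ ∧ I₂ ≠ ⊥) ∨ (a₁ ≠ ⊥ ∧ a₂ ≠ ⊥)) ∧
    ∃ (c : QuadCocycle (E.trivialModule L))
      (c₁ : QuadCocycle (E₁.trivialModule I₁)) (c₂ : QuadCocycle (E₂.trivialModule I₂)),
      c.cls = φ ∧
      c.α = a₁.subtype.compAlternatingMap
              (c₁.α.compLinearMap (Submodule.projectionOnto _ _ hI))
          + a₂.subtype.compAlternatingMap
              (c₂.α.compLinearMap (Submodule.projectionOnto _ _ hI.symm)) ∧
      c.γ = c₁.γ.compLinearMap (Submodule.projectionOnto _ _ hI)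
          + c₂.γ.compLinearMap (Submodule.projectionOnto _ _ hI.symm)

/-- The set `H²_Q(L, A)₀` of indecomposable admissible classes, `A` a pseudo-Euclidean space
considered as a trivial `L`-module. -/
def HQ0 (E : PseudoEuclidean A) : Set (HQ (E.trivialModule L)) :=
  {φ | Admissible (E.trivialModule L) φ ∧ ¬ Decomposable L E φ}

end Decomposable

/-- The Lie algebra `𝔤₅,₂ = {[X₁, X₂] = Y, [X₁, X₃] = Z}`, in coordinates with respect to the basis
`X₁, X₂, X₃, Y, Z`. -/
def G52 : Type := Fin 5 → ℝ

noncomputable instance : AddCommGroup G52 := inferInstanceAs (AddCommGroup (Fin 5 → ℝ))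

noncomputable instance : Module ℝ G52 := inferInstanceAs (Module ℝ (Fin 5 → ℝ))

/-- The bracket of `𝔤₅,₂`. -/
def G52.br (x y : Fin 5 → ℝ) : Fin 5 → ℝ :=
  ![0, 0, 0, x 0 * y 1 - x 1 * y 0, x 0 * y 2 - x 2 * y 0]

theorem G52.br_add_left (x y z : Fin 5 → ℝ) : br (x + y) z = br x z + br y z := by
  ext i; fin_cases i <;> simp [br] <;> ring

theorem G52.br_add_right (x y z : Fin 5 → ℝ) : br x (y + z) = br x y + br x z := by
  ext i; fin_cases i <;> simp [br] <;> ring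

theorem G52.br_self (x : Fin 5 → ℝ) : br x x = 0 := by
  ext i; fin_cases i <;> simp [br] <;> ring

theorem G52.br_leibniz (x y z : Fin 5 → ℝ) :
    br x (br y z) = br (br x y) z + br y (br x z) := by
  ext i; fin_cases i <;> simp [br]

theorem G52.br_smul (t : ℝ) (x y : Fin 5 → ℝ) : br x (t • y) = t • br x y := by
  ext i; fin_cases i <;> simp [br] <;> ring

noncomputable instance : LieRing G52 where
  bracket x y := G52.br x y
  add_lie x y z := G52.br_add_left x y z
  lie_add x y z := G52.br_add_right x y z
  lie_self x := G52.br_self x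
  leibniz_lie x y z := G52.br_leibniz x y z

noncomputable instance : LieAlgebra ℝ G52 where
  lie_smul t x y := G52.br_smul t x y

/-- The abelian Lie algebra `ℝⁿ`. -/
def AbelianLie (n : ℕ) : Type := Fin n → ℝ

noncomputable instance (n : ℕ) : AddCommGroup (AbelianLie n) :=
  inferInstanceAs (AddCommGroup (Fin n → ℝ))

noncomputable instance (n : ℕ) : Module ℝ (AbelianLie n) :=
  inferInstanceAs (Module ℝ (Fin n → ℝ))

noncomputable instance (n : ℕ) : LieRing (AbelianLie n) where
  bracket _ _ := 0
  add_lie _ _ _ := (add_zero 0).symm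
  lie_add _ _ _ := (add_zero 0).symm
  lie_self _ := rfl
  leibniz_lie _ _ _ := (add_zero 0).symm

noncomputable instance (n : ℕ) : LieAlgebra ℝ (AbelianLie n) where
  lie_smul t _ _ := (smul_zero t).symm

end QuadraticCohomology

namespace QuadraticCohomology

/-! ### Lower central series: termination and generators of its terms. -/

section Lcs

variable {L : Type*} [LieRing L] [LieAlgebra ℝ L]

/-! Write `L^(k+1)` for `lcs L k`. With zero coefficients a cocycle is a closed 3-form `γ`. On the
last non-zero term `N` of the series, which is central, the condition `(Aₖ)` with index that of `N`
says: if `u ∈ N` and `γ(L, u, N) = 0`, then `u = 0`.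

If `L` is not abelian, then `N` lies in `L²`. Since `γ` is alternating, a line `N` would violate the
condition, so `dim N ≥ 2` (`CondA.two_le_finrank`). Nilpotency gives `L²` codimension at least two,
so `dim L² ≤ 3`, and the dimensions drop strictly until zero. Hence `N` is `L²` or `L³`.

If `N = L³`, then `dim L² = 3` and `L` has two generators `a, b`. Closedness of `γ` forces `γ(L, L³,
L³) = 0`, contradicting the condition (`CondA.lcs_two_eq_bot`).

If `N = L²`, two generators would make `L²` at most a line. So `dim L² = 2`, and the three brackets
of three generators are dependent. Every bivector in three dimensions is decomposable, so the
relation yields two commuting generators, and the brackets of the third with these two complete a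
basis of `𝔤₅,₂`. -/

theorem lcs_succ_le_iff {k : ℕ} {S : Submodule ℝ L} :
    (lcs L (k + 1)).toSubmodule ≤ S ↔ ∀ x : L, ∀ y ∈ lcs L k, ⁅x, y⁆ ∈ S := by
  rw [lcs, LieModule.lowerCentralSeries_succ, LieSubmodule.lieIdeal_oper_eq_linear_span',
    Submodule.span_le]
  constructor
  · exact fun h x y hy => h ⟨x, trivial, y, hy, rfl⟩
  · rintro h _ ⟨x, -, y, hy, rfl⟩
    exact h x y hy

theorem lie_mem_lcs_succ {k : ℕ} (x : L) {y : L} (hy : y ∈ lcs L k) : ⁅x, y⁆ ∈ lcs L (k + 1) :=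
  lcs_succ_le_iff.1 le_rfl x y hy

theorem lcs_succ_le (k : ℕ) : lcs L (k + 1) ≤ lcs L k :=
  LieModule.antitone_lowerCentralSeries ℝ L L (Nat.le_succ k)

/-- Each term determines the next, so a series that stalls once is constant from there on and can
reach zero only if it is already zero. -/
theorem lcs_eq_bot_of_le_succ {k m : ℕ} (hm : lcs L m = ⊥) (h : lcs L k ≤ lcs L (k + 1)) :
    lcs L k = ⊥ := by
  have key : ∀ j, lcs L k ≤ lcs L (k + j) := by
    intro j
    induction j with
    | zero => exact le_rfl
    | succ j ih =>
      refine h.trans ?_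
      have : (lcs L (k + 1)).toSubmodule ≤ (lcs L (k + (j + 1))).toSubmodule :=
        lcs_succ_le_iff.2 fun x y hy => lie_mem_lcs_succ x (ih hy)
      exact this
  rw [eq_bot_iff, ← hm]
  exact (key m).trans (LieModule.antitone_lowerCentralSeries ℝ L L (Nat.le_add_left m k))

theorem finrank_lcs_succ_lt [FiniteDimensional ℝ L] {k m : ℕ} (hm : lcs L m = ⊥)
    (h : lcs L k ≠ ⊥) :
    Module.finrank ℝ (lcs L (k + 1)).toSubmodule < Module.finrank ℝ (lcs L k).toSubmodule := by
  apply Submodule.finrank_lt_finrank_of_lt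
  refine lt_of_le_of_ne (lcs_succ_le k) fun e => h (lcs_eq_bot_of_le_succ hm ?_)
  exact e.ge

/-- Modulo `L³`, the derived algebra is spanned by the brackets of elements of a complement. -/
theorem lcs_one_le {K S : Submodule ℝ L} (hK : K ⊔ (lcs L 1).toSubmodule = ⊤)
    (hS : (lcs L 2).toSubmodule ≤ S) (h : ∀ x ∈ K, ∀ y ∈ K, ⁅x, y⁆ ∈ S) :
    (lcs L 1).toSubmodule ≤ S := by
  refine lcs_succ_le_iff.2 fun x y _ => ?_
  obtain ⟨x₁, hx₁, x₂, hx₂, rfl⟩ := Submodule.mem_sup.1 (hK ▸ Submodule.mem_top : x ∈ _)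
  obtain ⟨y₁, hy₁, y₂, hy₂, rfl⟩ := Submodule.mem_sup.1 (hK ▸ Submodule.mem_top : y ∈ _)
  -- Any bracket with a component in `L²` lies in `L³`, hence in `S`.
  rw [add_lie, lie_add x₁, ← lie_skew x₂]
  exact S.add_mem (S.add_mem (h _ hx₁ _ hy₁) (hS (lie_mem_lcs_succ _ hy₂)))
    (S.neg_mem (hS (lie_mem_lcs_succ _ hx₂)))

/-- All brackets on the span of `a, b` are multiples of `⁅a, b⁆`, the coefficient being a
determinant. -/
theorem lcs_one_le_of_pair {a b : L} {S : Submodule ℝ L}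
    (hK : Submodule.span ℝ {a, b} ⊔ (lcs L 1).toSubmodule = ⊤)
    (hS : (lcs L 2).toSubmodule ≤ S) (h : ⁅a, b⁆ ∈ S) : (lcs L 1).toSubmodule ≤ S := by
  refine lcs_one_le hK hS fun x hx y hy => ?_
  obtain ⟨p, q, rfl⟩ := Submodule.mem_span_pair.1 hx
  obtain ⟨r, s, rfl⟩ := Submodule.mem_span_pair.1 hy
  have e : ⁅p • a + q • b, r • a + s • b⁆ = (p * s - q * r) • ⁅a, b⁆ := by
    simp only [add_lie, lie_add, smul_lie, lie_smul, lie_self, ← lie_skew b a]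
    module
  rw [e]
  exact S.smul_mem _ h

theorem lcs_one_le_of_triple {a b c : L} {S : Submodule ℝ L}
    (hK : Submodule.span ℝ {a, b, c} ⊔ (lcs L 1).toSubmodule = ⊤)
    (hS : (lcs L 2).toSubmodule ≤ S) (hab : ⁅a, b⁆ ∈ S) (hac : ⁅a, c⁆ ∈ S) (hbc : ⁅b, c⁆ ∈ S) :
    (lcs L 1).toSubmodule ≤ S := by
  refine lcs_one_le hK hS fun x hx y hy => ?_
  obtain ⟨p, q, r, rfl⟩ := Submodule.mem_span_triple.1 hx
  obtain ⟨p', q', r', rfl⟩ := Submodule.mem_span_triple.1 hy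
  have e : ⁅p • a + q • b + r • c, p' • a + q' • b + r' • c⁆
      = (p * q' - q * p') • ⁅a, b⁆ + (p * r' - r * p') • ⁅a, c⁆
        + (q * r' - r * q') • ⁅b, c⁆ := by
    simp only [add_lie, lie_add, smul_lie, lie_smul, lie_self, ← lie_skew b a, ← lie_skew c a,
      ← lie_skew c b]
    module
  rw [e]
  exact S.add_mem (S.add_mem (S.smul_mem _ hab) (S.smul_mem _ hac)) (S.smul_mem _ hbc)

/-- If `L` is generated by two elements and `L⁴ = 0`, then `L³` is spanned by two brackets. -/
theorem lcs_two_le_of_pair {a b : L} (hK : Submodule.span ℝ {a, b} ⊔ (lcs L 1).toSubmodule = ⊤)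
    (h3 : lcs L 3 = ⊥) :
    (lcs L 2).toSubmodule ≤ Submodule.span ℝ {⁅a, ⁅a, b⁆⁆, ⁅b, ⁅a, b⁆⁆} := by
  have hz : ∀ x : L, ∀ w ∈ lcs L 2, ⁅x, w⁆ = 0 := fun x w hw => by
    have := lie_mem_lcs_succ x hw
    rwa [h3] at this
  have h1 : (lcs L 1).toSubmodule ≤ Submodule.span ℝ {⁅a, b⁆} ⊔ (lcs L 2).toSubmodule :=
    lcs_one_le_of_pair hK le_sup_right
      (Submodule.mem_sup_left (Submodule.mem_span_singleton_self _))
  refine lcs_succ_le_iff.2 fun x y hy => ?_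
  obtain ⟨u, hu, x', hx', rfl⟩ := Submodule.mem_sup.1 (hK ▸ Submodule.mem_top : x ∈ _)
  obtain ⟨p, q, rfl⟩ := Submodule.mem_span_pair.1 hu
  -- Since `L³` is central, only the `⁅a, b⁆`-components of elements of `L²` matter, and two such
  -- components commute.
  obtain ⟨v, hv, w, hw, rfl⟩ := Submodule.mem_sup.1 (h1 hx')
  obtain ⟨r, rfl⟩ := Submodule.mem_span_singleton.1 hv
  obtain ⟨v', hv', w', hw', rfl⟩ := Submodule.mem_sup.1 (h1 hy)
  obtain ⟨s, rfl⟩ := Submodule.mem_span_singleton.1 hv'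
  refine Submodule.mem_span_pair.2 ⟨p * s, q * s, ?_⟩
  have hw0 : ⁅w, ⁅a, b⁆⁆ = 0 := by rw [← lie_skew, hz _ w hw, neg_zero]
  simp only [add_lie, lie_add, smul_lie, lie_smul, lie_self, hz _ w' hw', hw0]
  module

end Lcs

/-! ### Spanning families of prescribed length. -/

section Spanning

variable {V : Type*} [AddCommGroup V] [Module ℝ V] [FiniteDimensional ℝ V]

theorem exists_span_range_eq (K : Submodule ℝ V) {n : ℕ} (h : Module.finrank ℝ K ≤ n) :
    ∃ v : Fin n → V, Submodule.span ℝ (Set.range v) = K := by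
  have b := Module.finBasis ℝ K
  -- A basis of `K`, padded with zeros to length `n`.
  refine ⟨fun i => if hi : (i : ℕ) < Module.finrank ℝ K then (b ⟨i, hi⟩ : V) else 0,
    le_antisymm ?_ ?_⟩
  · rw [Submodule.span_le]
    rintro _ ⟨i, rfl⟩
    dsimp only
    split_ifs
    · exact Submodule.coe_mem _
    · exact K.zero_mem
  · have := congrArg (Submodule.map K.subtype) b.span_eq
    rw [Submodule.map_top, Submodule.range_subtype, Submodule.map_span] at this
    refine this.ge.trans (Submodule.span_mono ?_)
    rintro _ ⟨_, ⟨i, rfl⟩, rfl⟩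
    exact ⟨⟨i, i.2.trans_le h⟩, by simp⟩

/-- A complement of a subspace of codimension at most `n` is spanned by `n` vectors. -/
theorem exists_span_range_sup_eq_top (W : Submodule ℝ V) {n : ℕ}
    (h : Module.finrank ℝ V ≤ n + Module.finrank ℝ W) :
    ∃ v : Fin n → V, Submodule.span ℝ (Set.range v) ⊔ W = ⊤ := by
  obtain ⟨K, hK⟩ := W.exists_isCompl
  have := Submodule.finrank_add_eq_of_isCompl hK
  obtain ⟨v, hv⟩ := exists_span_range_eq K (n := n) (by omega)
  exact ⟨v, by rw [hv, sup_comm]; exact hK.sup_eq_top⟩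

end Spanning

/-! ### Symmetries of alternating 3-forms. -/

section Alternating

variable {L : Type*} [AddCommGroup L] [Module ℝ L] (γ : L [⋀^Fin 3]→ₗ[ℝ] ℝ)

theorem alternating_swap_left (x y z : L) : γ ![x, y, z] = -γ ![y, x, z] := by
  have h := γ.map_swap ![y, x, z] (i := 0) (j := 1) (by decide)
  rw [← h]
  congr 1
  ext i; fin_cases i <;> rfl

theorem alternating_swap_right (x y z : L) : γ ![x, y, z] = -γ ![x, z, y] := by
  have h := γ.map_swap ![x, z, y] (i := 1) (j := 2) (by decide)
  rw [← h]
  congr 1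
  ext i; fin_cases i <;> rfl

theorem alternating_rotate (x y z : L) : γ ![x, y, z] = γ ![z, x, y] := by
  rw [alternating_swap_right, alternating_swap_left, neg_neg]

theorem alternating_self_left (x y : L) : γ ![x, x, y] = 0 :=
  γ.map_eq_zero_of_eq _ (i := 0) (j := 1) rfl (by decide)

theorem alternating_self_outer (x y : L) : γ ![x, y, x] = 0 :=
  γ.map_eq_zero_of_eq _ (i := 0) (j := 2) rfl (by decide)

theorem alternating_zero_left (y z : L) : γ ![0, y, z] = 0 :=
  γ.map_coord_zero 0 rfl

theorem alternating_eq_zero_of_span {s : Set L} {u v : L} (h : ∀ x ∈ s, γ ![x, u, v] = 0) :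
    ∀ x ∈ Submodule.span ℝ s, γ ![x, u, v] = 0 := by
  intro x hx
  induction hx using Submodule.span_induction with
  | mem x hx => exact h x hx
  | zero => exact alternating_zero_left γ u v
  | add x y _ _ hx hy =>
    have := γ.map_vecCons_add ![u, v] x y
    rw [this, hx, hy, add_zero]
  | smul t x _ hx =>
    have := γ.map_vecCons_smul ![u, v] t x
    rw [this, hx, smul_zero]

end Alternating

/-! ### Consequences of `(Aₖ)` and closedness when the coefficients vanish. -/

section TrivialCoefficients

variable {L A : Type*} [LieRing L] [LieAlgebra ℝ L] [AddCommGroup A] [Module ℝ A]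
  [Subsingleton A]

/-- For zero coefficients, `(Aₖ)` at the last non-zero term of the lower central series. -/
theorem CondA.eq_zero {V : OrthogonalModule L A} {c : QuadCocycle V} {k : ℕ}
    (hA : CondA V c (k + 1)) (hk : lcs L (k + 2) = ⊥) {u : L} (hu : u ∈ lcs L (k + 1))
    (h : ∀ x : L, ∀ y ∈ lcs L (k + 1), c.γ ![x, u, y] = 0) : u = 0 := by
  -- The choice `A₀ = 0`, `Z₀ = 0` reduces the premise of `(Aₖ)` to the vanishing of `γ`.
  refine hA u ⟨?_, hu⟩ ⟨0, 0, fun x => ⟨Subsingleton.elim _ _, fun y => ?_⟩⟩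
  · refine (LieModule.mem_maxTrivSubmodule ℝ L L u).2 fun x => ?_
    have := lie_mem_lcs_succ x hu
    rwa [hk] at this
  · simp [h x y y.2]

/-- On a line spanned by `u`, the values `γ(x, u, t u)` all vanish by alternation, so `(Aₖ)` would
give `u = 0`. -/
theorem CondA.two_le_finrank [FiniteDimensional ℝ L] {V : OrthogonalModule L A}
    {c : QuadCocycle V} {k : ℕ} (hA : CondA V c (k + 1)) (hk : lcs L (k + 2) = ⊥)
    (hne : lcs L (k + 1) ≠ ⊥) : 2 ≤ Module.finrank ℝ (lcs L (k + 1)).toSubmodule := by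
  by_contra! hlt
  obtain ⟨v, hv⟩ := exists_span_range_eq (lcs L (k + 1)).toSubmodule (n := 1) (by omega)
  have hv' : Submodule.span ℝ {v 0} = (lcs L (k + 1)).toSubmodule := by
    rw [← hv, Set.range_unique]; rfl
  have h0 : v 0 = 0 := by
    refine hA.eq_zero hk (?_ : v 0 ∈ (lcs L (k + 1)).toSubmodule) fun x y hy => ?_
    · rw [← hv']; exact Submodule.mem_span_singleton_self _
    · replace hy : y ∈ (lcs L (k + 1)).toSubmodule := hy
      rw [← hv'] at hy
      rw [alternating_rotate]
      refine alternating_eq_zero_of_span _ ?_ y hy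
      rintro _ rfl
      exact alternating_self_outer _ _ _
  apply hne
  rw [← LieSubmodule.toSubmodule_eq_bot, ← hv', h0, Submodule.span_zero_singleton]

theorem QuadCocycle.d3R_eq_zero {V : OrthogonalModule L A} (c : QuadCocycle V) (x y z w : L) :
    d3R c.γ x y z w = 0 := by
  rw [c.d_γ]
  have h : ∀ p q : A, V.form p q = 0 := fun p q => by
    rw [Subsingleton.elim p 0, map_zero, LinearMap.zero_apply]
  simp [wedge22, h]

/-- If `L` is generated by two elements and `L⁴ = 0 ≠ L³`, then `(A₂)` fails. -/
theorem CondA.lcs_two_eq_bot {V : OrthogonalModule L A} {c : QuadCocycle V} (hA : CondA V c 2)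
    (h3 : lcs L 3 = ⊥) {a b : L}
    (hK : Submodule.span ℝ {a, b} ⊔ (lcs L 1).toSubmodule = ⊤) : lcs L 2 = ⊥ := by
  have h2 := lcs_two_le_of_pair hK h3
  have h1 : (lcs L 1).toSubmodule ≤ Submodule.span ℝ {⁅a, b⁆} ⊔ (lcs L 2).toSubmodule :=
    lcs_one_le_of_pair hK le_sup_right
      (Submodule.mem_sup_left (Submodule.mem_span_singleton_self _))
  have hc : ⁅a, b⁆ ∈ lcs L 1 := lie_mem_lcs_succ a (k := 0) (by simp [lcs])
  obtain ⟨z, hz⟩ : ∃ z, z = ⁅a, b⁆ := ⟨_, rfl⟩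
  rw [← hz] at h1 h2 hc
  obtain ⟨d, hd⟩ : ∃ d, d = ⁅a, z⁆ := ⟨_, rfl⟩
  obtain ⟨e, he⟩ : ∃ e, e = ⁅b, z⁆ := ⟨_, rfl⟩
  rw [← hd, ← he] at h2
  have hd2 : d ∈ lcs L 2 := hd ▸ lie_mem_lcs_succ a hc
  have he2 : e ∈ lcs L 2 := he ▸ lie_mem_lcs_succ b hc
  have hzero : ∀ x : L, ∀ w ∈ lcs L 2, ⁅x, w⁆ = 0 := fun x w hw => by
    have := lie_mem_lcs_succ x hw
    rwa [h3] at this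
  -- In `dγ(a, b, z, d)`, `dγ(a, b, z, e)` and `dγ(a, b, d, e)`, with `d`, `e` central, alternation
  -- leaves one term each: up to sign `γ(a, d, e)`, `γ(b, d, e)` and `γ(z, d, e)`.
  have ha : c.γ ![a, d, e] = 0 := by
    have := c.d3R_eq_zero a b z d
    simp only [d3R, hzero _ d hd2, ← hz, ← hd, ← he, alternating_self_left,
      alternating_self_outer, alternating_zero_left] at this
    rw [← alternating_rotate, alternating_rotate]
    rw [← alternating_rotate] at this
    linarith
  have hb : c.γ ![b, d, e] = 0 := by
    have := c.d3R_eq_zero a b z e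
    simp only [d3R, hzero _ e he2, ← hz, ← hd, ← he, alternating_self_left,
      alternating_self_outer, alternating_zero_left] at this
    rw [alternating_swap_left]
    linarith
  have hz0 : c.γ ![z, d, e] = 0 := by
    have := c.d3R_eq_zero a b d e
    simp only [d3R, hzero _ d hd2, hzero _ e he2, ← hz, alternating_zero_left] at this
    linarith
  have hall : ∀ x : L, c.γ ![x, d, e] = 0 := by
    have hle : (⊤ : Submodule ℝ L) ≤ Submodule.span ℝ {a, b, z, d, e} := by
      rw [← hK]
      refine sup_le (Submodule.span_mono ?_) (h1.trans (sup_le (Submodule.span_mono ?_)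
        (h2.trans (Submodule.span_mono ?_))))
      all_goals intro x hx; simp only [Set.mem_insert_iff, Set.mem_singleton_iff] at hx ⊢; tauto
    intro x
    refine alternating_eq_zero_of_span _ ?_ x (hle trivial)
    rintro _ (rfl | rfl | rfl | rfl | rfl)
    exacts [ha, hb, hz0, alternating_self_left _ _ _, alternating_self_outer _ _ _]
  -- As `L³` is spanned by `d, e`, the form `γ(x, d, ·)` on `L³` is determined by `γ(x, d, d) = 0`
  -- and `γ(x, d, e) = 0`.
  have hd0 : d = 0 := by
    refine hA.eq_zero h3 hd2 fun x y hy => ?_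
    rw [alternating_rotate]
    refine alternating_eq_zero_of_span _ ?_ y (h2 hy)
    rintro _ (rfl | rfl)
    · exact alternating_self_outer _ _ _
    · rw [← alternating_rotate, hall]
  have he0 : e = 0 := by
    refine hA.eq_zero h3 he2 fun x y hy => ?_
    rw [alternating_rotate]
    refine alternating_eq_zero_of_span _ ?_ y (h2 hy)
    rintro _ (rfl | rfl)
    · rw [← alternating_rotate, alternating_swap_right, hall, neg_zero]
    · exact alternating_self_outer _ _ _
  rw [← LieSubmodule.toSubmodule_eq_bot, eq_bot_iff]
  simpa [hd0, he0] using h2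

end TrivialCoefficients

/-! ### Recognising the two Lie algebras. -/

section Iso

variable {L : Type*} [LieRing L] [LieAlgebra ℝ L]

theorem nonempty_equiv_abelianLie [FiniteDimensional ℝ L] (h : lcs L 1 = ⊥) :
    Nonempty (L ≃ₗ⁅ℝ⁆ AbelianLie (Module.finrank ℝ L)) := by
  let e : L ≃ₗ[ℝ] AbelianLie (Module.finrank ℝ L) := (Module.finBasis ℝ L).equivFun
  refine ⟨{ e with map_lie' := fun {x y} => ?_ }⟩
  have h0 : ⁅x, y⁆ = 0 := by
    have := lie_mem_lcs_succ (k := 0) x (y := y) (by simp [lcs])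
    rwa [h] at this
  change e ⁅x, y⁆ = 0
  rw [h0, map_zero]

/-- Three vectors whose brackets satisfy a non-trivial linear relation can be replaced by three
vectors with the same span, two of which commute. -/
theorem exists_commuting_of_relation {a b c : L} {p q r : ℝ} (h : p ≠ 0 ∨ q ≠ 0 ∨ r ≠ 0)
    (hrel : p • ⁅a, b⁆ + q • ⁅a, c⁆ + r • ⁅b, c⁆ = 0) :
    ∃ x y z : L, Submodule.span ℝ {a, b, c} ≤ Submodule.span ℝ {x, y, z} ∧ ⁅y, z⁆ = 0 := by
  have hspan : ∀ {x y z : L}, a ∈ Submodule.span ℝ {x, y, z} → b ∈ Submodule.span ℝ {x, y, z} →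
      c ∈ Submodule.span ℝ {x, y, z} →
      Submodule.span ℝ {a, b, c} ≤ Submodule.span ℝ {x, y, z} := by
    intro x y z ha hb hc
    rw [Submodule.span_le]
    rintro _ (rfl | rfl | rfl) <;> assumption
  simp only [Submodule.mem_span_triple] at hspan
  -- The relation is the bivector `p a∧b + q a∧c + r b∧c`, to be factored. It equals `r b∧c` if `p =
  -- q = 0`, `(q a + r b)∧c` if only `p = 0`, and `p⁻¹ (p a - r c)∧(p b + q c)` otherwise.
  by_cases hp : p = 0
  · by_cases hq : q = 0
    · subst hp hq
      refine ⟨a, b, c, le_rfl, ?_⟩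
      have hr : r ≠ 0 := by simpa using h
      simpa [hr] using hrel
    · subst hp
      refine ⟨b, q • a + r • b, c, hspan ⟨-(q⁻¹ * r), q⁻¹, 0, ?_⟩ ⟨1, 0, 0, by simp⟩
        ⟨0, 0, 1, by simp⟩, ?_⟩
      · match_scalars <;> field_simp
        ring
      · simpa using hrel
  · refine ⟨c, p • a - r • c, p • b + q • c, hspan ⟨p⁻¹ * r, p⁻¹, 0, ?_⟩ ⟨-(p⁻¹ * q), 0, p⁻¹, ?_⟩
      ⟨1, 0, 0, by simp⟩, ?_⟩
    · match_scalars <;> field_simp <;> ring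
    · match_scalars <;> field_simp <;> ring
    · have : ⁅p • a - r • c, p • b + q • c⁆ = p • (p • ⁅a, b⁆ + q • ⁅a, c⁆ + r • ⁅b, c⁆) := by
        simp only [sub_lie, lie_add, smul_lie, lie_smul, lie_self, ← lie_skew c b]
        module
      rw [this, hrel, smul_zero]

/-- The vectors `a, b, c, ⁅a, b⁆, ⁅a, c⁆` span `L`, and there are as many as the dimension, so they
form a basis. It corresponds to `X₁, X₂, X₃, Y, Z`. -/
theorem nonempty_equiv_G52 (hL : Module.finrank ℝ L = 5) {a b c : L} (hbc : ⁅b, c⁆ = 0)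
    (h2 : lcs L 2 = ⊥) (hK : Submodule.span ℝ {a, b, c} ⊔ (lcs L 1).toSubmodule = ⊤) :
    Nonempty (L ≃ₗ⁅ℝ⁆ G52) := by
  have hz : ∀ x y z : L, ⁅x, ⁅y, z⁆⁆ = 0 := fun x y z => by
    have := lie_mem_lcs_succ (k := 1) x (lie_mem_lcs_succ (k := 0) y (y := z) (by simp [lcs]))
    rwa [h2] at this
  have hz' : ∀ x y z : L, ⁅⁅y, z⁆, x⁆ = 0 := fun x y z => by rw [← lie_skew, hz, neg_zero]
  let v : Fin 5 → L := ![a, b, c, ⁅a, b⁆, ⁅a, c⁆]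
  have hv : ∀ i, v i ∈ Submodule.span ℝ (Set.range v) := fun i =>
    Submodule.subset_span ⟨i, rfl⟩
  have htop : ⊤ ≤ Submodule.span ℝ (Set.range v) := by
    rw [← hK, sup_le_iff, Submodule.span_le]
    constructor
    · rintro _ (rfl | rfl | rfl)
      exacts [hv 0, hv 1, hv 2]
    · refine lcs_one_le_of_triple hK ?_ (hv 3) (hv 4) ?_
      · rw [h2]; exact bot_le
      · rw [hbc]; exact Submodule.zero_mem _
  let B := basisOfTopLeSpanOfCardEqFinrank v htop (by simp [hL])
  have hB : ∀ x : Fin 5 → ℝ, B.equivFun.symm x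
      = x 0 • a + x 1 • b + x 2 • c + x 3 • ⁅a, b⁆ + x 4 • ⁅a, c⁆ := by
    intro x
    rw [Module.Basis.equivFun_symm_apply, coe_basisOfTopLeSpanOfCardEqFinrank, Fin.sum_univ_five]
    rfl
  let e : G52 ≃ₗ[ℝ] L := B.equivFun.symm
  have e_lie : ∀ x y : Fin 5 → ℝ,
      B.equivFun.symm (G52.br x y) = ⁅B.equivFun.symm x, B.equivFun.symm y⁆ := by
    intro x y
    rw [hB, hB, hB]
    simp only [G52.br, add_lie, lie_add, smul_lie, lie_smul, lie_self, hz, hz', hbc,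
      ← lie_skew b a, ← lie_skew c a, ← lie_skew c b]
    simp [-lie_skew]
    module
  exact ⟨LieEquiv.symm { e with map_lie' := fun {x y} => e_lie x y }⟩

end Iso

/-! ### Dimension counts in dimension five. -/

section Dimension

variable {L A : Type*} [LieRing L] [LieAlgebra ℝ L] [FiniteDimensional ℝ L] [AddCommGroup A]
  [Module ℝ A] [Subsingleton A]

theorem exists_pair_sup_eq_top (W : Submodule ℝ L)
    (h : Module.finrank ℝ L ≤ 2 + Module.finrank ℝ W) :
    ∃ a b : L, Submodule.span ℝ {a, b} ⊔ W = ⊤ := by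
  obtain ⟨v, hv⟩ := exists_span_range_sup_eq_top W h
  refine ⟨v 0, v 1, ?_⟩
  rw [← hv]
  congr 2
  ext x
  simp [Fin.exists_fin_two, eq_comm]

theorem exists_triple_sup_eq_top (W : Submodule ℝ L)
    (h : Module.finrank ℝ L ≤ 3 + Module.finrank ℝ W) :
    ∃ a b c : L, Submodule.span ℝ {a, b, c} ⊔ W = ⊤ := by
  obtain ⟨v, hv⟩ := exists_span_range_sup_eq_top W h
  refine ⟨v 0, v 1, v 2, ?_⟩
  rw [← hv]
  congr 2
  ext x
  simp [Fin.exists_fin_succ, eq_comm]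

/-- The derived algebra of a non-abelian nilpotent Lie algebra has codimension at least two. -/
theorem finrank_lcs_one_add_two_le {m : ℕ} (hm : lcs L m = ⊥) (h : lcs L 1 ≠ ⊥) :
    Module.finrank ℝ (lcs L 1).toSubmodule + 2 ≤ Module.finrank ℝ L := by
  by_contra! hlt
  obtain ⟨v, hv⟩ := exists_span_range_sup_eq_top (n := 1) (lcs L 1).toSubmodule (by omega)
  rw [Set.range_unique] at hv
  refine h (lcs_eq_bot_of_le_succ hm ?_)
  -- With a single generator, taken twice as a pair, the only generating bracket is zero, so `L² ⊆
  -- L³`.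
  have : (lcs L 1).toSubmodule ≤ (lcs L 2).toSubmodule := by
    refine lcs_one_le_of_pair (a := v default) (b := v default) (by simpa using hv) le_rfl ?_
    rw [lie_self]
    exact Submodule.zero_mem _
  exact this

/-- A five-dimensional Lie algebra with `L³ = 0` and `dim L² ≥ 2` is `𝔤₅,₂`. -/
theorem nonempty_equiv_G52_of_two_le (hL : Module.finrank ℝ L = 5) (h2 : lcs L 2 = ⊥)
    (hW : 2 ≤ Module.finrank ℝ (lcs L 1).toSubmodule) : Nonempty (L ≃ₗ⁅ℝ⁆ G52) := by
  have hle {S : Submodule ℝ L} : (lcs L 2).toSubmodule ≤ S := by rw [h2]; exact bot_le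
  have hW2 : Module.finrank ℝ (lcs L 1).toSubmodule = 2 := by
    -- Dimension at least three would leave two generators, and then `L²` would be spanned by their
    -- bracket.
    by_contra hne
    obtain ⟨a, b, hab⟩ := exists_pair_sup_eq_top (lcs L 1).toSubmodule (by omega)
    have h1 := Submodule.finrank_mono
      (lcs_one_le_of_pair hab hle (Submodule.mem_span_singleton_self ⁅a, b⁆))
    have := finrank_span_le_card (R := ℝ) {⁅a, b⁆}
    rw [Set.toFinset_singleton, Finset.card_singleton] at this
    omega
  obtain ⟨a, b, c, habc⟩ := exists_triple_sup_eq_top (lcs L 1).toSubmodule (by omega)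
  have hmem : ∀ x y : L, ⁅x, y⁆ ∈ (lcs L 1).toSubmodule := fun x y =>
    lie_mem_lcs_succ (k := 0) x (y := y) (by simp [lcs])
  have hdep : ¬ LinearIndependent ℝ ![⁅a, b⁆, ⁅a, c⁆, ⁅b, c⁆] := by
    intro hli
    have h1 := finrank_span_eq_card hli
    have h2 : Submodule.span ℝ (Set.range ![⁅a, b⁆, ⁅a, c⁆, ⁅b, c⁆])
        ≤ (lcs L 1).toSubmodule := by
      rw [Submodule.span_le]
      rintro _ ⟨i, rfl⟩
      fin_cases i <;> exact hmem _ _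
    have h3 := Submodule.finrank_mono h2
    simp only [Fintype.card_fin] at h1
    omega
  rw [Fintype.not_linearIndependent_iff] at hdep
  obtain ⟨g, hg, i, hi⟩ := hdep
  have hne : g 0 ≠ 0 ∨ g 1 ≠ 0 ∨ g 2 ≠ 0 := by fin_cases i <;> simp_all
  have hrel : g 0 • ⁅a, b⁆ + g 1 • ⁅a, c⁆ + g 2 • ⁅b, c⁆ = 0 := by
    simpa [Fin.sum_univ_three] using hg
  obtain ⟨x, y, z, hxyz, hyz⟩ := exists_commuting_of_relation hne hrel
  exact nonempty_equiv_G52 hL hyz h2 (top_le_iff.1 (habc ▸ sup_le_sup_right hxyz _))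

/-- Over zero coefficients, a non-abelian nilpotent Lie algebra of dimension five with a cocycle
satisfying `(Aₖ)` at the last non-zero term of the lower central series has `L³ = 0` and
`dim L² ≥ 2`. -/
theorem lcs_two_eq_bot_of_condA {V : OrthogonalModule L A} {c : QuadCocycle V}
    (hL : Module.finrank ℝ L = 5) {k : ℕ} (hA : CondA V c (k + 1)) (hk : lcs L (k + 2) = ⊥)
    (hne : lcs L (k + 1) ≠ ⊥) :
    lcs L 2 = ⊥ ∧ 2 ≤ Module.finrank ℝ (lcs L 1).toSubmodule := by
  have hW := hA.two_le_finrank hk hne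
  have hne' : ∀ j ≤ k + 1, lcs L j ≠ ⊥ := fun j hj e => hne <| eq_bot_iff.2 <|
    (LieModule.antitone_lowerCentralSeries ℝ L L hj).trans e.le
  have h1 := finrank_lcs_one_add_two_le hk (hne' 1 (by omega))
  match k, hA, hk, hne, hW, hne' with
  | 0, hA, hk, hne, hW, hne' => exact ⟨hk, hW⟩
  -- Here `dim L³ ≥ 2` forces `dim L² ≥ 3`, so two elements generate `L` modulo `L²`.
  | 1, hA, hk, hne, hW, hne' =>
    have h12 := finrank_lcs_succ_lt hk (hne' 1 (by omega))
    obtain ⟨a, b, hab⟩ := exists_pair_sup_eq_top (lcs L 1).toSubmodule (by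
      simp only [Nat.reduceAdd] at h12 hW; omega)
    exact absurd (hA.lcs_two_eq_bot hk hab) hne
  -- From `dim L² ≤ 3`, two strict drops give `dim L⁴ ≤ 1`, but `L⁴` contains the last non-zero
  -- term, of dimension at least two.
  | k + 2, hA, hk, hne, hW, hne' =>
    have h12 := finrank_lcs_succ_lt hk (hne' 1 (by omega))
    have h23 := finrank_lcs_succ_lt hk (hne' 2 (by omega))
    have hle : (lcs L (k + 2 + 1)).toSubmodule ≤ (lcs L 3).toSubmodule :=
      LieModule.antitone_lowerCentralSeries ℝ L L (by omega)
    have h3 := Submodule.finrank_mono hle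
    simp only [Nat.reduceAdd] at h12 h23
    omega

end Dimension

end QuadraticCohomology

theorem proposition4 (L : Type*) [LieRing L] [LieAlgebra ℝ L] [LieRing.IsNilpotent L]
    (hL : Module.finrank ℝ L = 5)
    (A : Type*) [AddCommGroup A] [Module ℝ A] [Subsingleton A]
    (E : QuadraticCohomology.PseudoEuclidean A)
    (h : (QuadraticCohomology.HQ0 L E).Nonempty) :
    Nonempty (L ≃ₗ⁅ℝ⁆ QuadraticCohomology.AbelianLie 5) ∨
      Nonempty (L ≃ₗ⁅ℝ⁆ QuadraticCohomology.G52) := by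
  open QuadraticCohomology in
  have : FiniteDimensional ℝ L := Module.finite_of_finrank_pos (by omega)
  obtain ⟨φ, ⟨c, -, -, m, hm, hc⟩, -⟩ := h
  classical
  have hex : ∃ n, lcs L (n + 1) = ⊥ := ⟨m, hm⟩
  -- The `m` in admissibility need not be minimal. The least such `n` marks the last non-zero term,
  -- and `n ≤ m` makes `(Aₖ)` available at `k = n`.
  obtain ⟨n, hn⟩ : ∃ n, n = Nat.find hex := ⟨_, rfl⟩
  have hn1 : lcs L (n + 1) = ⊥ := hn ▸ Nat.find_spec hex
  have hnm : n ≤ m := hn ▸ Nat.find_min' hex hm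
  match n, hn, hn1, hnm with
  | 0, _, hn1, _ =>
    left
    rw [← hL]
    exact nonempty_equiv_abelianLie hn1
  | k + 1, hn, hn1, hnm =>
    right
    have hne : lcs L (k + 1) ≠ ⊥ := Nat.find_min hex (by omega)
    obtain ⟨h2, hW⟩ := lcs_two_eq_bot_of_condA hL (hc _ hnm).1 hn1 hne
    exact nonempty_equiv_G52_of_two_le hL h2 hW
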